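/- For every positive integer $k$ put $p_k=\log_2\binom{2k}{k}$. Then for all real $a,b\ge 0$, $$\sum_{j=0}^{k}\binom{k}{j}^2 a^{p_k(k-j)/k}\, b^{p_k j/k}\le (a+b)^{p_k},$$ where $0^0$ is read as $1$. Moreover, $p_k$ is the smallest exponent with this property: if $p$ is a real number such that $$\sum_{j=0}^{k}\binom{k}{j}^2 a^{p(k-j)/k}\, b^{p j/k}\le (a+b)^{p}$$ for all real $a,b\ge 0$, then $p\ge p_k$. -/

import Mathlib

/-- The exponent `p_k = log₂ (2k choose k)`. -/
noncomputable def pExp (k : ℕ) : ℝ := Real.logb 2 ((2 * k).choose k : ℝ)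

/-- The binomial sum `∑_{j=0}^k (k choose j)² a^{p(k-j)/k} b^{pj/k}` with exponent `p`;
all powers are real powers, with `0 ^ 0 = 1`. -/
noncomputable def binomSum (k : ℕ) (p a b : ℝ) : ℝ :=
  ∑ j ∈ Finset.range (k + 1),
    (k.choose j : ℝ) ^ 2 * a ^ (p * ((k : ℝ) - (j : ℝ)) / (k : ℝ)) * b ^ (p * (j : ℝ) / (k : ℝ))

open Filter Topology Finset

/-! By homogeneity and symmetry take a = e^(x-s), b = e^(x+s) with s ≥ 0. With p = `pExp k`, l = k/p
and u = s/l, the inequality becomes G(u) ≤ (2 cosh(lu))^p, where G = `chooseSqSum k`. The ratio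
G(u)/cosh(lu)^p equals 2^p at u = 0 by the choice of p, and also tends to 2^p at infinity, so it
suffices that it decreases and then increases. The sign of its derivative is that of `wronsk`.
Legendre's equation for G makes the derivative of `scaledWronsk` a nonnegative factor times k
sinh((2l-1)u) - l sinh u (`hasDerivAt_scaledWronsk`). Since k ≤ p ≤ 2k, we have 0 ≤ 2l-1 ≤ 1, and
this difference can only pass from positive to negative. As `scaledWronsk` vanishes at infinity, it
cannot return below zero once nonnegative (`scaledWronsk_nonneg_of_le`). Optimality of p comes from
a = b = 1. -/

/-- The exponential sum `∑_{j=0}^k d_j e^{(2j-k)u}`. -/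
noncomputable def expSum (k : ℕ) (d : ℕ → ℝ) (u : ℝ) : ℝ :=
  ∑ j ∈ range (k + 1), d j * Real.exp ((2 * (j : ℝ) - k) * u)

theorem hasDerivAt_expSum (k : ℕ) (d : ℕ → ℝ) (u : ℝ) :
    HasDerivAt (expSum k d) (expSum k (fun j => d j * (2 * (j : ℝ) - k)) u) u := by
  unfold expSum
  refine HasDerivAt.fun_sum fun j _ => ?_
  have h := (((hasDerivAt_id u).const_mul (2 * (j : ℝ) - k)).exp).const_mul (d j)
  refine h.congr_deriv ?_
  simp only [id]
  ring

theorem tendsto_exp_neg_mul {c : ℝ} (hc : c < 0) :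
    Tendsto (fun u : ℝ => Real.exp (c * u)) atTop (𝓝 0) :=
  Real.tendsto_exp_atBot.comp (tendsto_id.const_mul_atTop_of_neg hc)

theorem tendsto_expSum_mul_exp (k : ℕ) (d : ℕ → ℝ) :
    Tendsto (fun u => expSum k d u * Real.exp (-(k * u))) atTop (𝓝 (d k)) := by
  have h : ∀ u, expSum k d u * Real.exp (-(k * u))
      = ∑ j ∈ range k, d j * Real.exp ((2 * (j : ℝ) - 2 * k) * u) + d k := by
    intro u
    rw [expSum, sum_range_succ, add_mul, sum_mul]
    congr 1
    · refine sum_congr rfl fun j _ => ?_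
      rw [mul_assoc, ← Real.exp_add]
      ring_nf
    · rw [mul_assoc, ← Real.exp_add]
      ring_nf
      simp
  simp_rw [h]
  have h0 : Tendsto (fun u => ∑ j ∈ range k, d j * Real.exp ((2 * (j : ℝ) - 2 * k) * u))
      atTop (𝓝 (∑ j ∈ range k, d j * 0)) := by
    refine tendsto_finsetSum _ fun j hj => (tendsto_exp_neg_mul ?_).const_mul _
    have : (j : ℝ) < k := by exact_mod_cast mem_range.1 hj
    linarith
  simpa using h0.add_const (d k)

/-- The sum `∑_{j=0}^k (k choose j)² e^{(2j-k)u}`. -/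
noncomputable def chooseSqSum (k : ℕ) : ℝ → ℝ := expSum k fun j => (k.choose j : ℝ) ^ 2

/-- The derivative of `chooseSqSum`. -/
noncomputable def chooseSqSum' (k : ℕ) : ℝ → ℝ :=
  expSum k fun j => (k.choose j : ℝ) ^ 2 * (2 * (j : ℝ) - k)

/-- The second derivative of `chooseSqSum`. -/
noncomputable def chooseSqSum'' (k : ℕ) : ℝ → ℝ :=
  expSum k fun j => (k.choose j : ℝ) ^ 2 * (2 * (j : ℝ) - k) * (2 * (j : ℝ) - k)

theorem hasDerivAt_chooseSqSum (k : ℕ) (u : ℝ) :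
    HasDerivAt (chooseSqSum k) (chooseSqSum' k u) u := hasDerivAt_expSum k _ u

theorem hasDerivAt_chooseSqSum' (k : ℕ) (u : ℝ) :
    HasDerivAt (chooseSqSum' k) (chooseSqSum'' k u) u := hasDerivAt_expSum k _ u

theorem chooseSqSum_nonneg (k : ℕ) (u : ℝ) : 0 ≤ chooseSqSum k u :=
  by unfold chooseSqSum expSum; positivity

theorem sum_choose_sq (k : ℕ) :
    ∑ j ∈ range (k + 1), (k.choose j : ℝ) ^ 2 = ((2 * k).choose k : ℝ) := by
  exact_mod_cast Nat.sum_range_choose_sq k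

theorem chooseSqSum_zero (k : ℕ) : chooseSqSum k 0 = ((2 * k).choose k : ℝ) := by
  simp [chooseSqSum, expSum, sum_choose_sq]

/-- A form of Legendre's differential equation. -/
theorem chooseSqSum_ode (k : ℕ) (u : ℝ) :
    Real.sinh u * chooseSqSum'' k u
      = 2 * k * Real.cosh u * chooseSqSum' k u - k ^ 2 * Real.sinh u * chooseSqSum k u := by
  -- The equation telescopes: the j-th terms combine to T (j+1) - T j. The factor j² kills T 0, and
  -- `k.choose (k+1) = 0` kills T (k+1).
  set T : ℕ → ℝ := fun j =>
    2 * (k.choose j : ℝ) ^ 2 * (j : ℝ) ^ 2 * Real.exp ((2 * (j : ℝ) - k - 1) * u) with hT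
  have key : ∀ j ∈ range (k + 1),
      Real.sinh u * ((k.choose j : ℝ) ^ 2 * (2 * (j : ℝ) - k) * (2 * (j : ℝ) - k)
          * Real.exp ((2 * (j : ℝ) - k) * u))
        - 2 * k * Real.cosh u * ((k.choose j : ℝ) ^ 2 * (2 * (j : ℝ) - k)
          * Real.exp ((2 * (j : ℝ) - k) * u))
        + k ^ 2 * Real.sinh u * ((k.choose j : ℝ) ^ 2 * Real.exp ((2 * (j : ℝ) - k) * u))
      = T (j + 1) - T j := by
    intro j hj
    have hjk : j ≤ k := Nat.lt_succ_iff.1 (mem_range.1 hj)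
    have hc : (k.choose (j + 1) : ℝ) * ((j : ℝ) + 1) = k.choose j * ((k : ℝ) - j) := by
      have := Nat.choose_succ_right_eq k j
      have h2 : ((k.choose (j + 1) * (j + 1) : ℕ) : ℝ) = ((k.choose j * (k - j) : ℕ) : ℝ) := by
        rw [this]
      push_cast [Nat.cast_sub hjk] at h2
      exact h2
    have e1 : Real.exp ((2 * ((j + 1 : ℕ) : ℝ) - k - 1) * u)
        = Real.exp ((2 * (j : ℝ) - k) * u) * Real.exp u := by
      rw [← Real.exp_add]; push_cast; ring_nf
    have e2 : Real.exp ((2 * (j : ℝ) - k - 1) * u)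
        = Real.exp ((2 * (j : ℝ) - k) * u) * Real.exp (-u) := by
      rw [← Real.exp_add]; ring_nf
    simp only [hT]
    rw [e1, e2, Real.sinh_eq, Real.cosh_eq]
    have hc2 : (k.choose (j + 1) : ℝ) ^ 2 * (((j + 1 : ℕ) : ℝ)) ^ 2
        = (k.choose j : ℝ) ^ 2 * ((k : ℝ) - j) ^ 2 := by
      push_cast
      rw [← mul_pow, hc, mul_pow]
    linear_combination (-2 * Real.exp ((2 * (j : ℝ) - k) * u) * Real.exp u) * hc2
  have hsum := sum_congr rfl key
  rw [sum_range_sub, sum_add_distrib, sum_sub_distrib, ← mul_sum, ← mul_sum, ← mul_sum] at hsum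
  have h1 : T (k + 1) = 0 := by simp [hT]
  have h0 : T 0 = 0 := by simp [hT]
  rw [h1, h0] at hsum
  simp only [chooseSqSum, chooseSqSum', chooseSqSum'', expSum]
  linarith

/-! ### Monotonicity of sinh(cx)/sinh x. -/

theorem sinh_mul_cosh_mul_le {c x : ℝ} (hc0 : 0 ≤ c) (hc1 : c ≤ 1) (hx : 0 ≤ x) :
    c * Real.cosh (c * x) * Real.sinh x ≤ Real.sinh (c * x) * Real.cosh x := by
  have hd : ∀ y : ℝ, HasDerivAt
      (fun y => Real.sinh (c * y) * Real.cosh y - c * Real.cosh (c * y) * Real.sinh y)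
      ((1 - c ^ 2) * (Real.sinh (c * y) * Real.sinh y)) y := by
    intro y
    have hl : HasDerivAt (fun y : ℝ => c * y) c y := by
      simpa using (hasDerivAt_id y).const_mul c
    refine ((hl.sinh.mul (Real.hasDerivAt_cosh y)).sub
      ((hl.cosh.const_mul c).mul (Real.hasDerivAt_sinh y))).congr_deriv ?_
    ring
  have hmono : MonotoneOn
      (fun y => Real.sinh (c * y) * Real.cosh y - c * Real.cosh (c * y) * Real.sinh y)
      (Set.Ici 0) := by
    refine monotoneOn_of_hasDerivWithinAt_nonneg (convex_Ici 0)
      (fun y _ => (hd y).continuousAt.continuousWithinAt)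
      (fun y _ => (hd y).hasDerivWithinAt) fun y hy => ?_
    rw [interior_Ici, Set.mem_Ioi] at hy
    have h1 : 0 ≤ Real.sinh (c * y) := Real.sinh_nonneg_iff.2 (by positivity)
    have h2 : 0 ≤ Real.sinh y := Real.sinh_nonneg_iff.2 hy.le
    have h3 : 0 ≤ 1 - c ^ 2 := by nlinarith
    positivity
  have := hmono (Set.self_mem_Ici) (Set.mem_Ici.2 hx) hx
  simp at this
  linarith

theorem antitoneOn_sinh_mul_div_sinh {c : ℝ} (hc0 : 0 ≤ c) (hc1 : c ≤ 1) :
    AntitoneOn (fun x => Real.sinh (c * x) / Real.sinh x) (Set.Ioi 0) := by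
  have hd : ∀ y : ℝ, 0 < y → HasDerivAt (fun x => Real.sinh (c * x) / Real.sinh x)
      ((Real.cosh (c * y) * c * Real.sinh y - Real.sinh (c * y) * Real.cosh y)
        / Real.sinh y ^ 2) y := by
    intro y hy
    have hl : HasDerivAt (fun y : ℝ => c * y) c y := by
      simpa using (hasDerivAt_id y).const_mul c
    exact hl.sinh.div (Real.hasDerivAt_sinh y) (Real.sinh_pos_iff.2 hy).ne'
  refine antitoneOn_of_hasDerivWithinAt_nonpos (convex_Ioi 0)
    (fun y hy => (hd y hy).continuousAt.continuousWithinAt)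
    (fun y hy => (hd y (interior_subset hy)).hasDerivWithinAt) fun y hy => ?_
  rw [interior_Ioi, Set.mem_Ioi] at hy
  have := sinh_mul_cosh_mul_le hc0 hc1 hy.le
  exact div_nonpos_of_nonpos_of_nonneg (by linarith) (by positivity)

/-- Dividing by sinh leaves an antitone function minus a constant; hence at most one sign change. -/
theorem sinh_comb_nonpos_of_le {k l c u v : ℝ} (hk : 0 ≤ k) (hc0 : 0 ≤ c) (hc1 : c ≤ 1)
    (hu : 0 < u) (huv : u ≤ v) (h : k * Real.sinh (c * u) - l * Real.sinh u ≤ 0) :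
    k * Real.sinh (c * v) - l * Real.sinh v ≤ 0 := by
  have hsu := Real.sinh_pos_iff.2 hu
  have hsv := Real.sinh_pos_iff.2 (hu.trans_le huv)
  have h1 := antitoneOn_sinh_mul_div_sinh hc0 hc1 hu (hu.trans_le huv) huv
  simp only at h1
  have h2 : k * (Real.sinh (c * u) / Real.sinh u) ≤ l := by
    rw [← mul_div_assoc, div_le_iff₀ hsu]; linarith
  have h3 : k * (Real.sinh (c * v) / Real.sinh v) ≤ l :=
    (mul_le_mul_of_nonneg_left h1 hk).trans h2
  rw [← mul_div_assoc, div_le_iff₀ hsv] at h3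
  linarith

/-! ### Sign of the Wronskian. -/

/-- The Wronskian-type numerator of the derivative of `chooseSqSum k u / cosh (l u) ^ (k / l)`. -/
noncomputable def wronsk (k : ℕ) (l u : ℝ) : ℝ :=
  chooseSqSum' k u * Real.cosh (l * u) - k * chooseSqSum k u * Real.sinh (l * u)

/-- `wronsk` multiplied by an integrating factor. -/
noncomputable def scaledWronsk (k : ℕ) (p l u : ℝ) : ℝ :=
  wronsk k l u * Real.cosh (l * u) ^ (p - 1) / Real.sinh u ^ (2 * k)

/-- The integrating factor is chosen so that, after the Legendre equation removes G'', the terms in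
G' cancel and only a multiple of G remains. -/
theorem hasDerivAt_scaledWronsk {k : ℕ} {p l u : ℝ} (hpl : p * l = k) (hu : 0 < u) :
    HasDerivAt (scaledWronsk k p l)
      (Real.cosh (l * u) ^ (p - 2) / Real.sinh u ^ (2 * k + 1) * (k * chooseSqSum k u)
        * (k * Real.sinh ((2 * l - 1) * u) - l * Real.sinh u)) u := by
  have hs := Real.sinh_pos_iff.2 hu
  have hl : HasDerivAt (fun y : ℝ => l * y) l u := by
    simpa using (hasDerivAt_id u).const_mul l
  have hE : HasDerivAt (wronsk k l)
      (chooseSqSum'' k u * Real.cosh (l * u) + chooseSqSum' k u * (Real.sinh (l * u) * l)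
        - (k * chooseSqSum' k u * Real.sinh (l * u)
          + k * chooseSqSum k u * (Real.cosh (l * u) * l))) u :=
    ((hasDerivAt_chooseSqSum' k u).mul hl.cosh).sub
      (((hasDerivAt_chooseSqSum k u).const_mul (k : ℝ)).mul hl.sinh)
  have hC := Real.cosh_pos (l * u)
  have hP := hl.cosh.rpow_const (p := p - 1) (Or.inl hC.ne')
  have hS := (Real.hasDerivAt_sinh u).pow (2 * k)
  have h := (hE.mul hP).div hS (pow_ne_zero _ hs.ne')
  refine h.congr_deriv ?_
  have hp1 : Real.cosh (l * u) ^ (p - 1) = Real.cosh (l * u) ^ (p - 2) * Real.cosh (l * u) := by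
    rw [← Real.rpow_add_one hC.ne']; ring_nf
  have hp2 : p - 1 - 1 = p - 2 := by ring
  have hpow : ((2 * k : ℕ) : ℝ) * Real.sinh u ^ (2 * k - 1) * Real.sinh u
      = 2 * k * Real.sinh u ^ (2 * k) := by
    rcases Nat.eq_zero_or_pos k with rfl | hk
    · simp
    · rw [mul_assoc, ← pow_succ, Nat.sub_add_cancel (by omega)]; push_cast; ring
  have hadd : Real.sinh ((2 * l - 1) * u)
      = 2 * Real.sinh (l * u) * Real.cosh (l * u) * Real.cosh u
        - (Real.cosh (l * u) ^ 2 + Real.sinh (l * u) ^ 2) * Real.sinh u := by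
    rw [show (2 * l - 1) * u = 2 * (l * u) - u by ring, Real.sinh_sub, Real.sinh_two_mul,
      Real.cosh_two_mul]
  have hone := Real.cosh_sq_sub_sinh_sq (l * u)
  have hode := chooseSqSum_ode k u
  simp only [Pi.mul_apply, Pi.pow_apply]
  rw [hp2, hp1, hadd, wronsk]
  set X := Real.cosh (l * u) ^ (p - 2)
  set C := Real.cosh (l * u)
  set S := Real.sinh (l * u)
  set s := Real.sinh u
  set c := Real.cosh u
  set G := chooseSqSum k u
  set G1 := chooseSqSum' k u
  set G2 := chooseSqSum'' k u
  set P := s ^ (2 * k) with hPdef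
  set Q := s ^ (2 * k - 1)
  have hPne : P ≠ 0 := pow_ne_zero _ hs.ne'
  have hsne : s ≠ 0 := hs.ne'
  rw [pow_succ s, ← hPdef, div_eq_iff (pow_ne_zero _ hPne)]
  have hR : ∀ W, X / (P * s) * (k * G) * W * P ^ 2 = X * (k * G) * W * P / s := by
    intro W
    field_simp
  rw [hR, eq_div_iff hsne]
  linear_combination (-(G1 * C - k * G * S) * X * C * c) * hpow + (X * C ^ 2 * P) * hode
    + ((G1 * C - k * G * S) * S * X * P * s) * hpl - (k * G * l * s * X * P) * hone

theorem tendsto_chooseSqSum_mul_exp (k : ℕ) :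
    Tendsto (fun u => chooseSqSum k u * Real.exp (-(k * u))) atTop (𝓝 1) := by
  have := tendsto_expSum_mul_exp k fun j => (k.choose j : ℝ) ^ 2
  rwa [Nat.choose_self, Nat.cast_one, one_pow] at this

theorem tendsto_cosh_mul_exp {l : ℝ} (hl : 0 < l) :
    Tendsto (fun u => Real.cosh (l * u) * Real.exp (-(l * u))) atTop (𝓝 (1 / 2)) := by
  have h : ∀ u, Real.cosh (l * u) * Real.exp (-(l * u)) = (1 + Real.exp (-(2 * l) * u)) / 2 := by
    intro u
    rw [Real.cosh_eq, div_mul_eq_mul_div, add_mul, ← Real.exp_add, ← Real.exp_add]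
    ring_nf
    simp
  simp_rw [h]
  have := ((tendsto_exp_neg_mul (c := -(2 * l)) (by linarith)).const_add 1).div_const 2
  simpa using this

theorem tendsto_sinh_mul_exp {l : ℝ} (hl : 0 < l) :
    Tendsto (fun u => Real.sinh (l * u) * Real.exp (-(l * u))) atTop (𝓝 (1 / 2)) := by
  have h : ∀ u, Real.sinh (l * u) * Real.exp (-(l * u)) = (1 - Real.exp (-(2 * l) * u)) / 2 := by
    intro u
    rw [Real.sinh_eq, div_mul_eq_mul_div, sub_mul, ← Real.exp_add, ← Real.exp_add]
    ring_nf
    simp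
  simp_rw [h]
  have := ((tendsto_exp_neg_mul (c := -(2 * l)) (by linarith)).const_sub 1).div_const 2
  simpa using this

/-- Numerator and denominator both have exponential order 2k, because k + l + l(p-1) = 2k, and the
leading coefficients in `wronsk` cancel. -/
theorem tendsto_scaledWronsk {k : ℕ} {p l : ℝ} (hl : 0 < l) (hpl : p * l = k) :
    Tendsto (scaledWronsk k p l) atTop (𝓝 0) := by
  have hG := tendsto_chooseSqSum_mul_exp k
  have hG' : Tendsto (fun u => chooseSqSum' k u * Real.exp (-(k * u))) atTop (𝓝 (k : ℝ)) := by
    have := tendsto_expSum_mul_exp k fun j => (k.choose j : ℝ) ^ 2 * (2 * (j : ℝ) - k)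
    rwa [Nat.choose_self, Nat.cast_one, one_pow, one_mul, two_mul, add_sub_cancel_right] at this
  have hC := tendsto_cosh_mul_exp hl
  have hS := tendsto_sinh_mul_exp hl
  have hs : Tendsto (fun u => Real.sinh u * Real.exp (-u)) atTop (𝓝 (1 / 2)) := by
    simpa using tendsto_sinh_mul_exp one_pos
  have h := ((((hG'.mul hC).sub ((hG.const_mul (k : ℝ)).mul hS)).mul
    (hC.rpow_const (p := p - 1) (Or.inl (by norm_num)))).div (hs.pow (2 * k)) (by positivity))
  have h0 : ((k : ℝ) * (1 / 2) - (k : ℝ) * 1 * (1 / 2)) * (1 / 2) ^ (p - 1) / (1 / 2) ^ (2 * k)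
      = 0 := by ring
  rw [h0] at h
  refine h.congr fun u => ?_
  have hexp : Real.exp (-(k * u)) * Real.exp (-(l * u)) * Real.exp (-(l * u)) ^ (p - 1)
      = Real.exp (-u) ^ (2 * k) := by
    rw [← Real.exp_mul, ← Real.exp_nat_mul, ← Real.exp_add, ← Real.exp_add]
    congr 1
    push_cast
    linear_combination (-u) * hpl
  simp only [Pi.div_apply]
  rw [scaledWronsk, wronsk, Real.mul_rpow (Real.cosh_pos _).le (Real.exp_pos _).le, mul_pow,
    ← hexp]
  have := (Real.exp_pos (-(k * u))).ne'
  have := (Real.exp_pos (-(l * u))).ne'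
  have := (Real.rpow_pos_of_pos (Real.exp_pos (-(l * u))) (p - 1)).ne'
  rw [← mul_div_mul_right _ (Real.sinh u ^ (2 * k))
    (mul_ne_zero (mul_ne_zero ‹Real.exp (-(k * u)) ≠ 0› ‹Real.exp (-(l * u)) ≠ 0›) this)]
  ring

/-- Once `wronsk` is nonnegative, it stays so. -/
theorem scaledWronsk_nonneg_of_le {k : ℕ} {p l u v : ℝ} (hl : 1 / 2 ≤ l) (hl1 : l ≤ 1)
    (hpl : p * l = k) (hu : 0 < u) (huv : u ≤ v) (h : 0 ≤ scaledWronsk k p l u) :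
    0 ≤ scaledWronsk k p l v := by
  have hc0 : 0 ≤ 2 * l - 1 := by linarith
  have hc1 : 2 * l - 1 ≤ 1 := by linarith
  have hv := hu.trans_le huv
  have hfac : ∀ x : ℝ, 0 < x →
      0 ≤ Real.cosh (l * x) ^ (p - 2) / Real.sinh x ^ (2 * k + 1) * (k * chooseSqSum k x) := by
    intro x hx
    have h1 := chooseSqSum_nonneg k x
    have h2 := Real.sinh_pos_iff.2 hx
    have h3 := Real.cosh_pos (l * x)
    positivity
  -- If the derivative is already nonpositive at v, the function decreases from v on to its limit 0;
  -- otherwise it has increased throughout [u, v].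
  by_cases hS : k * Real.sinh ((2 * l - 1) * v) - l * Real.sinh v ≤ 0
  · have hanti : AntitoneOn (scaledWronsk k p l) (Set.Ici v) := by
      refine antitoneOn_of_hasDerivWithinAt_nonpos (convex_Ici v)
        (fun y hy => (hasDerivAt_scaledWronsk hpl
          (hv.trans_le hy)).continuousAt.continuousWithinAt)
        (fun y hy => (hasDerivAt_scaledWronsk hpl
          (hv.trans_le (interior_subset hy))).hasDerivWithinAt) fun y hy => ?_
      have hy' := interior_subset hy
      exact mul_nonpos_of_nonneg_of_nonpos (hfac y (hv.trans_le hy'))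
        (sinh_comb_nonpos_of_le (Nat.cast_nonneg k) hc0 hc1 hv hy' hS)
    refine le_of_tendsto (tendsto_scaledWronsk (by linarith) hpl) ?_
    filter_upwards [eventually_ge_atTop v] with y hy
    exact hanti Set.self_mem_Ici hy hy
  · have hmono : MonotoneOn (scaledWronsk k p l) (Set.Icc u v) := by
      refine monotoneOn_of_hasDerivWithinAt_nonneg (convex_Icc u v)
        (fun y hy => (hasDerivAt_scaledWronsk hpl
          (hu.trans_le hy.1)).continuousAt.continuousWithinAt)
        (fun y hy => (hasDerivAt_scaledWronsk hpl
          (hu.trans_le (interior_subset hy).1)).hasDerivWithinAt) fun y hy => ?_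
      have hy' := interior_subset hy
      refine mul_nonneg (hfac y (hu.trans_le hy'.1)) ?_
      by_contra hneg
      exact hS (sinh_comb_nonpos_of_le (Nat.cast_nonneg k) hc0 hc1 (hu.trans_le hy'.1) hy'.2
        (not_le.1 hneg).le)
    exact h.trans (hmono (Set.left_mem_Icc.2 huv) (Set.right_mem_Icc.2 huv) huv)

theorem wronsk_nonneg_iff {k : ℕ} {p l u : ℝ} (hu : 0 < u) :
    0 ≤ scaledWronsk k p l u ↔ 0 ≤ wronsk k l u := by
  have h2 := pow_pos (Real.sinh_pos_iff.2 hu) (2 * k)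
  have h3 := Real.rpow_pos_of_pos (Real.cosh_pos (l * u)) (p - 1)
  rw [scaledWronsk, le_div_iff₀ h2, zero_mul, mul_nonneg_iff_of_pos_right h3]

/-! ### The ratio G(u)/cosh(lu)^p and its bound. -/

theorem hasDerivAt_chooseSqSum_mul_cosh_rpow {k : ℕ} {p l : ℝ} (hpl : p * l = k) (u : ℝ) :
    HasDerivAt (fun u => chooseSqSum k u * Real.cosh (l * u) ^ (-p))
      (Real.cosh (l * u) ^ (-p - 1) * wronsk k l u) u := by
  have hl : HasDerivAt (fun y : ℝ => l * y) l u := by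
    simpa using (hasDerivAt_id u).const_mul l
  have hC := Real.cosh_pos (l * u)
  refine ((hasDerivAt_chooseSqSum k u).mul
    (hl.cosh.rpow_const (p := -p) (Or.inl hC.ne'))).congr_deriv ?_
  have hp1 : Real.cosh (l * u) ^ (-p) = Real.cosh (l * u) ^ (-p - 1) * Real.cosh (l * u) := by
    rw [← Real.rpow_add_one hC.ne']; ring_nf
  rw [hp1, wronsk]
  linear_combination
    (-(chooseSqSum k u * Real.sinh (l * u) * Real.cosh (l * u) ^ (-p - 1))) * hpl

theorem tendsto_chooseSqSum_mul_cosh_rpow {k : ℕ} {p l : ℝ} (hl : 0 < l) (hpl : p * l = k) :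
    Tendsto (fun u => chooseSqSum k u * Real.cosh (l * u) ^ (-p)) atTop (𝓝 (2 ^ p)) := by
  have hG := tendsto_chooseSqSum_mul_exp k
  have h := hG.mul ((tendsto_cosh_mul_exp hl).rpow_const (p := -p) (Or.inl (by norm_num)))
  have h0 : (1 : ℝ) * (1 / 2) ^ (-p) = 2 ^ p := by
    rw [one_mul, one_div, Real.inv_rpow (by norm_num), Real.rpow_neg (by norm_num), inv_inv]
  rw [h0] at h
  refine h.congr fun u => ?_
  have hexp : Real.exp (-(k * u)) * Real.exp (-(l * u)) ^ (-p) = 1 := by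
    rw [← Real.exp_mul, ← Real.exp_add, Real.exp_eq_one_iff]
    linear_combination u * hpl
  rw [Real.mul_rpow (Real.cosh_pos _).le (Real.exp_pos _).le]
  linear_combination (chooseSqSum k u * Real.cosh (l * u) ^ (-p)) * hexp

theorem chooseSqSum_le_two_mul_cosh_rpow {k : ℕ} {p l u : ℝ} (hl : 1 / 2 ≤ l) (hl1 : l ≤ 1)
    (hpl : p * l = k) (hp : ((2 * k).choose k : ℝ) = 2 ^ p) (hu : 0 ≤ u) :
    chooseSqSum k u ≤ (2 * Real.cosh (l * u)) ^ p := by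
  have hd := hasDerivAt_chooseSqSum_mul_cosh_rpow hpl
  suffices h : chooseSqSum k u * Real.cosh (l * u) ^ (-p) ≤ 2 ^ p by
    have hC := Real.cosh_pos (l * u)
    rw [Real.rpow_neg hC.le, ← div_eq_mul_inv, div_le_iff₀ (Real.rpow_pos_of_pos hC p)] at h
    rwa [Real.mul_rpow (by norm_num) hC.le]
  have hfac : ∀ x : ℝ, 0 ≤ Real.cosh (l * x) ^ (-p - 1) := fun x =>
    (Real.rpow_pos_of_pos (Real.cosh_pos _) _).le
  rcases hu.eq_or_lt with rfl | hu
  · simp [chooseSqSum_zero, hp]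
  -- Either the ratio increases from u towards its limit 2^p, or it has decreased on [0, u] from its
  -- initial value 2^p.
  by_cases hE : 0 ≤ wronsk k l u
  · have hmono : MonotoneOn (fun u => chooseSqSum k u * Real.cosh (l * u) ^ (-p))
        (Set.Ici u) := by
      refine monotoneOn_of_hasDerivWithinAt_nonneg (convex_Ici u)
        (fun y _ => (hd y).continuousAt.continuousWithinAt)
        (fun y _ => (hd y).hasDerivWithinAt) fun y hy => ?_
      have hy' : u ≤ y := interior_subset hy
      exact mul_nonneg (hfac y) ((wronsk_nonneg_iff (p := p) (hu.trans_le hy')).1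
        (scaledWronsk_nonneg_of_le hl hl1 hpl hu hy' ((wronsk_nonneg_iff hu).2 hE)))
    refine ge_of_tendsto (tendsto_chooseSqSum_mul_cosh_rpow (by linarith) hpl) ?_
    filter_upwards [eventually_ge_atTop u] with y hy
    exact hmono Set.self_mem_Ici hy hy
  · have hanti : AntitoneOn (fun u => chooseSqSum k u * Real.cosh (l * u) ^ (-p))
        (Set.Icc 0 u) := by
      refine antitoneOn_of_hasDerivWithinAt_nonpos (convex_Icc 0 u)
        (fun y _ => (hd y).continuousAt.continuousWithinAt)
        (fun y _ => (hd y).hasDerivWithinAt) fun y hy => ?_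
      rw [interior_Icc] at hy
      refine mul_nonpos_of_nonneg_of_nonpos (hfac y) ?_
      by_contra hpos
      exact hE ((wronsk_nonneg_iff (p := p) hu).1 (scaledWronsk_nonneg_of_le hl hl1 hpl hy.1
        hy.2.le ((wronsk_nonneg_iff hy.1).2 (not_le.1 hpos).le)))
    have := hanti (Set.left_mem_Icc.2 hu.le) (Set.right_mem_Icc.2 hu.le) hu.le
    simpa [chooseSqSum_zero, hp] using this

/-! ### Bounds on the exponent and return to a, b. -/

theorem two_rpow_pExp (k : ℕ) : (2 : ℝ) ^ pExp k = ((2 * k).choose k : ℝ) :=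
  Real.rpow_logb (by norm_num) (by norm_num)
    (by exact_mod_cast Nat.choose_pos (by omega : k ≤ 2 * k))

theorem pExp_le_two_mul (k : ℕ) : pExp k ≤ 2 * k := by
  rw [← Real.rpow_le_rpow_left_iff (x := 2) (by norm_num), two_rpow_pExp]
  have : ((2 * k).choose k : ℝ) ≤ (2 : ℝ) ^ (2 * k) := by
    exact_mod_cast Nat.choose_le_two_pow (2 * k) k
  exact_mod_cast this

theorem le_pExp (k : ℕ) : (k : ℝ) ≤ pExp k := by
  rw [← Real.rpow_le_rpow_left_iff (x := 2) (by norm_num), two_rpow_pExp, Real.rpow_natCast]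
  have h : 2 ^ k ≤ (2 * k).choose k := by
    rw [← Nat.sum_range_choose, ← Nat.sum_range_choose_sq]
    exact sum_le_sum fun j _ => Nat.le_self_pow two_ne_zero _
  exact_mod_cast h

theorem binomSum_comm (k : ℕ) (p a b : ℝ) : binomSum k p a b = binomSum k p b a := by
  unfold binomSum
  rw [← sum_flip]
  refine sum_congr rfl fun j hj => ?_
  have hjk : j ≤ k := Nat.lt_succ_iff.1 (mem_range.1 hj)
  rw [Nat.choose_symm hjk, Nat.cast_sub hjk, sub_sub_cancel]
  ring

theorem binomSum_zero_right {k : ℕ} (hk : 0 < k) {p : ℝ} (hp : 0 < p) (a : ℝ) :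
    binomSum k p a 0 = a ^ p := by
  have hk' : (0 : ℝ) < k := by exact_mod_cast hk
  unfold binomSum
  rw [sum_range_succ', sum_eq_zero]
  · simp [hk'.ne']
  · intro j _
    rw [Real.zero_rpow, mul_zero]
    positivity

theorem binomSum_exp {k : ℕ} (hk : 0 < k) (p x s : ℝ) :
    binomSum k p (Real.exp (x - s)) (Real.exp (x + s))
      = Real.exp (x * p) * chooseSqSum k (p * s / k) := by
  have hk' : (k : ℝ) ≠ 0 := by exact_mod_cast hk.ne'
  simp only [binomSum, chooseSqSum, expSum]
  rw [mul_sum]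
  refine sum_congr rfl fun j _ => ?_
  rw [← Real.exp_mul, ← Real.exp_mul, mul_assoc, ← Real.exp_add, mul_left_comm, ← Real.exp_add]
  congr 2
  field_simp
  ring

theorem binomSum_pExp_le_of_le {k : ℕ} (hk : 0 < k) {a b : ℝ} (ha : 0 < a) (hab : a ≤ b) :
    binomSum k (pExp k) a b ≤ (a + b) ^ pExp k := by
  have hk' : (0 : ℝ) < k := by exact_mod_cast hk
  have hp : 0 < pExp k := hk'.trans_le (le_pExp k)
  obtain ⟨x, s, hs, rfl, rfl⟩ :
      ∃ x s : ℝ, 0 ≤ s ∧ a = Real.exp (x - s) ∧ b = Real.exp (x + s) := by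
    refine ⟨(Real.log a + Real.log b) / 2, (Real.log b - Real.log a) / 2, ?_, ?_, ?_⟩
    · linarith [Real.log_le_log ha hab]
    · rw [show (Real.log a + Real.log b) / 2 - (Real.log b - Real.log a) / 2 = Real.log a by ring,
        Real.exp_log ha]
    · rw [show (Real.log a + Real.log b) / 2 + (Real.log b - Real.log a) / 2 = Real.log b by ring,
        Real.exp_log (ha.trans_le hab)]
  have h := chooseSqSum_le_two_mul_cosh_rpow (k := k) (p := pExp k) (l := k / pExp k)
    (u := pExp k * s / k)
    (by rw [div_le_div_iff₀ (by norm_num) hp]; linarith [pExp_le_two_mul k])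
    (by rw [div_le_one hp]; exact le_pExp k) (by field_simp) (two_rpow_pExp k).symm
    (by positivity)
  rw [show k / pExp k * (pExp k * s / k) = s by field_simp] at h
  have hsum : Real.exp (x - s) + Real.exp (x + s) = Real.exp x * (2 * Real.cosh s) := by
    rw [Real.cosh_eq, sub_eq_add_neg, Real.exp_add, Real.exp_add]
    ring
  rw [binomSum_exp hk, hsum, Real.mul_rpow (Real.exp_pos x).le
    (mul_pos two_pos (Real.cosh_pos s)).le, ← Real.exp_mul]
  exact mul_le_mul_of_nonneg_left h (Real.exp_pos _).le

theorem theorem1 (k : ℕ) (hk : 0 < k) :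
    (∀ a b : ℝ, 0 ≤ a → 0 ≤ b → binomSum k (pExp k) a b ≤ (a + b) ^ pExp k) ∧
    (∀ p : ℝ, (∀ a b : ℝ, 0 ≤ a → 0 ≤ b → binomSum k p a b ≤ (a + b) ^ p) → pExp k ≤ p) := by
  have hp : 0 < pExp k := (Nat.cast_pos.2 hk).trans_le (le_pExp k)
  refine ⟨fun a b ha hb => ?_, fun p h => ?_⟩
  · rcases ha.eq_or_lt with rfl | ha
    · rw [binomSum_comm, binomSum_zero_right hk hp, zero_add]
    rcases hb.eq_or_lt with rfl | hb
    · rw [binomSum_zero_right hk hp, add_zero]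
    rcases le_total a b with hab | hab
    · exact binomSum_pExp_le_of_le hk ha hab
    · rw [binomSum_comm, add_comm]
      exact binomSum_pExp_le_of_le hk hb hab
  -- At a = b = 1 the sum is the central binomial coefficient whatever p is.
  · have h1 := h 1 1 zero_le_one zero_le_one
    simp only [binomSum, Real.one_rpow, mul_one, sum_choose_sq] at h1
    rw [one_add_one_eq_two, ← two_rpow_pExp] at h1
    exact (Real.rpow_le_rpow_left_iff (by norm_num)).1 h1
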